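/- For a bit string $z\in\{0,1\}^n$ let $w(z)$ be its Hamming weight, and let $f(z)=w(z)$ for $z\neq 1^n$ and $f(1^n)=-1$. Let $|z\rangle$ denote the computational basis of $\mathbb{C}^{2^n}$ and let $|\hat z\rangle=|\hat z_1\rangle\otimes\cdots\otimes|\hat z_n\rangle$ denote the Hadamard basis, where $|\hat 0\rangle=\frac{1}{\sqrt2}(|0\rangle+|1\rangle)$ and $|\hat 1\rangle=\frac{1}{\sqrt2}(|0\rangle-|1\rangle)$. For $0\le s\le 1$ put $$H_f(s)=(1-s)\sum_{z\in\{0,1\}^n} w(z)\,|\hat z\rangle\langle\hat z| + s\sum_{z\in\{0,1\}^n} f(z)\,|z\rangle\langle z|,$$ and let $g_n(s)$ be the difference between the two smallest eigenvalues of the Hermitian matrix $H_f(s)$, counted with multiplicity. Then: 1. for every $n\ge 1$ the minimum $g_{\min}(n)=\min_{0\le s\le 1} g_n(s)$ exists; 2. $g_{\min}(n)= O\!\left(n/\sqrt{2^n}\right)$ as $n\to\infty$; 3. consequently, every delay $T=T(n)$ that meets the adiabatic requirement $T=\Omega(g_{\min}^{-2})$ (that is, there is a constant $c>0$ with $T(n)\,g_{\min}(n)^2\ge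 c$ for all sufficiently large $n$) satisfies $T=\Omega(2^n/n^2)$. -/

import Mathlib

open Filter Asymptotics

namespace Adiabatic

/-- The bit strings of length `n`. -/
abbrev BitString (n : ℕ) : Type := Fin n → Bool

/-- The Hamming weight `w(z)`: the number of ones in `z`. -/
def hammingWeight {n : ℕ} (z : BitString n) : ℕ :=
  (Finset.univ.filter fun i => z i = true).card

/-- The all-ones string `1^n`. -/
def allOnes (n : ℕ) : BitString n := fun _ => true

/-- The perturbed Hamming weight: `f(z) = w(z)` for `z ≠ 1^n` and `f(1^n) = -1`. -/
def perturbedWeight {n : ℕ} (z : BitString n) : ℝ :=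
  if z = allOnes n then -1 else (hammingWeight z : ℝ)

/-- The computational basis vector `|z⟩`, for one bit or for a string. -/
def ket {ι : Type} [DecidableEq ι] (z : ι) : ι → ℂ := Pi.single z 1

/-- The one-qubit Hadamard basis: `|0̂⟩ = (|0⟩ + |1⟩)/√2` and `|1̂⟩ = (|0⟩ - |1⟩)/√2`. -/
noncomputable def hatBit : Bool → Bool → ℂ
  | false => ((1 / Real.sqrt 2 : ℝ) : ℂ) • (ket false + ket true)
  | true => ((1 / Real.sqrt 2 : ℝ) : ℂ) • (ket false - ket true)

/-- The Hadamard basis vector `|ẑ⟩`, the tensor product of the vectors `|ẑ_i⟩`;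
its `x`-coordinate is the product of the coordinates of the factors. -/
noncomputable def hatKet {n : ℕ} (z : BitString n) : BitString n → ℂ :=
  fun x => ∏ i, hatBit (z i) (x i)

/-- The rank-one matrix `|v⟩⟨v|`. -/
def ketbra {ι : Type} (v : ι → ℂ) : Matrix ι ι ℂ := Matrix.vecMulVec v (star v)

/-- The initial Hamiltonian `∑_z w(z) |ẑ⟩⟨ẑ|`. -/
noncomputable def initialHamiltonian (n : ℕ) : Matrix (BitString n) (BitString n) ℂ :=
  ∑ z : BitString n, (hammingWeight z : ℂ) • ketbra (hatKet z)

/-- The final Hamiltonian `∑_z f(z) |z⟩⟨z|` of a function `f` on bit strings. -/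
noncomputable def finalHamiltonian {n : ℕ} (f : BitString n → ℝ) :
    Matrix (BitString n) (BitString n) ℂ :=
  ∑ z : BitString n, (f z : ℂ) • ketbra (ket z)

/-- The interpolated Hamiltonian `H_f(s) = (1 - s) ∑_z w(z) |ẑ⟩⟨ẑ| + s ∑_z f(z) |z⟩⟨z|`. -/
noncomputable def hamiltonian {n : ℕ} (f : BitString n → ℝ) (s : ℝ) :
    Matrix (BitString n) (BitString n) ℂ :=
  ((1 - s : ℝ) : ℂ) • initialHamiltonian n + (s : ℂ) • finalHamiltonian f

theorem ketbra_isHermitian {ι : Type} (v : ι → ℂ) : (ketbra v).IsHermitian := by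
  ext i j
  simp [ketbra, Matrix.vecMulVec_apply, mul_comm]

theorem ofReal_smul_isHermitian {ι : Type} {A : Matrix ι ι ℂ} (hA : A.IsHermitian) (r : ℝ) :
    ((r : ℂ) • A).IsHermitian := by
  unfold Matrix.IsHermitian
  rw [Matrix.conjTranspose_smul, hA.eq]
  simp

theorem sum_ofReal_smul_ketbra_isHermitian {n : ℕ} (r : BitString n → ℝ)
    (v : BitString n → BitString n → ℂ) :
    (∑ z : BitString n, (r z : ℂ) • ketbra (v z)).IsHermitian := by
  unfold Matrix.IsHermitian
  rw [Matrix.conjTranspose_sum]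
  exact Finset.sum_congr rfl fun z _ =>
    (ofReal_smul_isHermitian (ketbra_isHermitian (v z)) (r z)).eq

theorem hamiltonian_isHermitian {n : ℕ} (f : BitString n → ℝ) (s : ℝ) :
    (hamiltonian f s).IsHermitian := by
  refine (ofReal_smul_isHermitian ?_ (1 - s)).add (ofReal_smul_isHermitian ?_ s)
  · simpa [initialHamiltonian] using
      sum_ofReal_smul_ketbra_isHermitian (fun z : BitString n => (hammingWeight z : ℝ)) hatKet
  · exact sum_ofReal_smul_ketbra_isHermitian f ket

/-- The difference between the two smallest eigenvalues, counted with multiplicity, of a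
Hermitian matrix of size at least two. Mathlib's `eigenvalues₀` lists the eigenvalues in
decreasing order, so these are the last two entries. -/
noncomputable def spectralGap {ι : Type} [Fintype ι] [DecidableEq ι] [Nonempty ι]
    {A : Matrix ι ι ℂ} (hA : A.IsHermitian) : ℝ :=
  hA.eigenvalues₀ ⟨Fintype.card ι - 2, Nat.sub_lt Fintype.card_pos (by norm_num)⟩ -
    hA.eigenvalues₀ ⟨Fintype.card ι - 1, Nat.sub_lt Fintype.card_pos (by norm_num)⟩

/-- The gap `g(s)` between the two smallest eigenvalues of `H_f(s)`. -/
noncomputable def gap {n : ℕ} (f : BitString n → ℝ) (s : ℝ) : ℝ :=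
  spectralGap (hamiltonian_isHermitian f s)

/-- The minimum gap `g_min = min_{0 ≤ s ≤ 1} g(s)`, written as an infimum. -/
noncomputable def minGap {n : ℕ} (f : BitString n → ℝ) : ℝ :=
  sInf (gap f '' Set.Icc (0 : ℝ) 1)

/-- The adiabatic requirement `T ≥ c · g_min⁻²` on the delay `T` of the evolution from the
initial Hamiltonian to the final Hamiltonian of `f`. It is written without division, so that
no delay meets it when `c > 0` and `g_min = 0`. -/
def MeetsAdiabaticRequirement {n : ℕ} (f : BitString n → ℝ) (c T : ℝ) : Prop :=
  c ≤ T * minGap f ^ 2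

end Adiabatic

/-! With `w` in place of `f` the Hamiltonian is a sum of one-qubit terms, so the tensor power of the
one-qubit ground state is an exact eigenvector, with energy `n * qubitEnergy s`. Passing to `f`
subtracts `s (n+1) |1^n⟩⟨1^n|`, so this vector keeps a residual supported on `1^n` alone
(`hamiltonian_mulVec_productVector`). The ground state carries at most half its weight on `|1⟩` in
each qubit, so the residual is at most `(n+1)/√(2^n)` times the norm of the vector. Hence for every
`s` some eigenvalue of `H_f(s)` lies that close to `n * qubitEnergy s`
(`norm_residual_productVector_le`).

The midpoint of the two lowest eigenvalues is at least `n * qubitEnergy s` at `s = 0` and at most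
that at `s = 1`, so by continuity the two agree at some `s`. There every eigenvalue is at least half
the gap away from the midpoint, so the gap is at most `2(n+1)/√(2^n)` (`minGap_le`). The bound on
the delay follows by squaring. -/

namespace Adiabatic

/-! ### Operators diagonalised by an orthonormal basis -/

section Spectral

variable {𝕜 E ι κ : Type*} [RCLike 𝕜] [NormedAddCommGroup E] [InnerProductSpace 𝕜 E]
  [Fintype ι] [Fintype κ]

theorem inner_map_eq_of_eigenbasis (b : OrthonormalBasis ι 𝕜 E) (T : E →ₗ[𝕜] E) (μ : ι → ℝ)
    (hT : ∀ i, T (b i) = (μ i : 𝕜) • b i) (v : E) (i : ι) :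
    inner 𝕜 (b i) (T v) = (μ i : 𝕜) * inner 𝕜 (b i) v := by
  classical
  conv_lhs => rw [← b.sum_repr' v]
  simp [map_sum, hT, inner_sum, inner_smul_right, b.inner_eq_ite, mul_comm]

theorem re_inner_map_eq_sum (b : OrthonormalBasis ι 𝕜 E) (T : E →ₗ[𝕜] E) (μ : ι → ℝ)
    (hT : ∀ i, T (b i) = (μ i : 𝕜) • b i) (v : E) :
    RCLike.re (inner 𝕜 v (T v)) = ∑ i, μ i * ‖inner 𝕜 (b i) v‖ ^ 2 := by
  rw [← b.sum_inner_mul_inner v (T v), map_sum]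
  refine Finset.sum_congr rfl fun i _ => ?_
  rw [inner_map_eq_of_eigenbasis b T μ hT, mul_left_comm, ← inner_conj_symm, RCLike.conj_mul]
  norm_cast

theorem inner_eq_zero_of_mem_span (b : OrthonormalBasis ι 𝕜 E) {S : Finset ι} {v : E}
    (hv : v ∈ Submodule.span 𝕜 (b '' S)) {i : ι} (hi : i ∉ S) : inner 𝕜 (b i) v = 0 := by
  classical
  induction hv using Submodule.span_induction with
  | mem x hx =>
    obtain ⟨j, hj, rfl⟩ := hx
    rw [b.inner_eq_ite, if_neg]
    rintro rfl
    exact hi hj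
  | zero => simp
  | add x y _ _ hx hy => simp [inner_add_right, hx, hy]
  | smul a x _ hx => simp [inner_smul_right, hx]

theorem finrank_span_orthonormalBasis_image (b : OrthonormalBasis ι 𝕜 E) (S : Finset ι) :
    Module.finrank 𝕜 (Submodule.span 𝕜 (b '' S)) = S.card := by
  have h := finrank_span_eq_card (R := 𝕜) (b := fun i : S => b i)
    (b.orthonormal.linearIndependent.comp _ Subtype.val_injective)
  rw [Set.image_eq_range]
  simpa using h

/-- Comparison of the eigenvalues of two diagonalised operators: if the index sets `S` and `S'`
together have more elements than the dimension, then a lower bound of the eigenvalues of `T` on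
`S` is at most an upper bound of the eigenvalues of `T'` on `S'`, up to the distance of the
quadratic forms. -/
theorem eigenvalue_comparison (b : OrthonormalBasis ι 𝕜 E) (b' : OrthonormalBasis κ 𝕜 E)
    {T T' : E →ₗ[𝕜] E} {μ : ι → ℝ} {μ' : κ → ℝ}
    (hT : ∀ i, T (b i) = (μ i : 𝕜) • b i) (hT' : ∀ i, T' (b' i) = (μ' i : 𝕜) • b' i)
    {ε : ℝ} (hε : ∀ v, RCLike.re (inner 𝕜 v (T v)) ≤ RCLike.re (inner 𝕜 v (T' v)) + ε * ‖v‖ ^ 2)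
    {S : Finset ι} {S' : Finset κ} (hcard : Fintype.card ι < S.card + S'.card)
    {a c : ℝ} (ha : ∀ i ∈ S, a ≤ μ i) (hc : ∀ i ∈ S', μ' i ≤ c) : a ≤ c + ε := by
  have : FiniteDimensional 𝕜 E := b.toBasis.finiteDimensional_of_finite
  set U := Submodule.span 𝕜 (b '' S)
  set W := Submodule.span 𝕜 (b' '' S')
  -- The dimensions of `U` and `W` add up to more than that of `E`, so they share a nonzero vector,
  -- on which both quadratic forms are controlled.
  have hUW : ¬ Disjoint U W := fun h => by
    have h1 := Submodule.finrank_add_finrank_le_of_disjoint h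
    rw [finrank_span_orthonormalBasis_image, finrank_span_orthonormalBasis_image,
      Module.finrank_eq_card_basis b.toBasis] at h1
    omega
  obtain ⟨v, hv, hv0⟩ := Submodule.exists_mem_ne_zero_of_ne_bot (mt disjoint_iff.mpr hUW)
  have h1 : a * ‖v‖ ^ 2 ≤ RCLike.re (inner 𝕜 v (T v)) := by
    rw [re_inner_map_eq_sum b T μ hT, ← b.sum_sq_norm_inner_right v, Finset.mul_sum]
    refine Finset.sum_le_sum fun i _ => ?_
    by_cases hi : i ∈ S
    · exact mul_le_mul_of_nonneg_right (ha i hi) (sq_nonneg _)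
    · simp [inner_eq_zero_of_mem_span b hv.1 hi]
  have h2 : RCLike.re (inner 𝕜 v (T' v)) ≤ c * ‖v‖ ^ 2 := by
    rw [re_inner_map_eq_sum b' T' μ' hT', ← b'.sum_sq_norm_inner_right v, Finset.mul_sum]
    refine Finset.sum_le_sum fun i _ => ?_
    by_cases hi : i ∈ S'
    · exact mul_le_mul_of_nonneg_right (hc i hi) (sq_nonneg _)
    · simp [inner_eq_zero_of_mem_span b' hv.2 hi]
  have h3 : 0 < ‖v‖ ^ 2 := by positivity
  nlinarith [hε v]

/-- In the eigenbasis, `T - l` multiplies the `i`-th coordinate by `μ i - l`. Read contrapositively,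
a small residual forces an eigenvalue close to `l`. -/
theorem sq_mul_norm_sq_le_residual (b : OrthonormalBasis ι 𝕜 E) {T : E →ₗ[𝕜] E} {μ : ι → ℝ}
    (hT : ∀ i, T (b i) = (μ i : 𝕜) • b i) {d l : ℝ} (hd : 0 ≤ d) (hμ : ∀ i, d ≤ |μ i - l|)
    (v : E) : d ^ 2 * ‖v‖ ^ 2 ≤ ‖T v - (l : 𝕜) • v‖ ^ 2 := by
  rw [← b.sum_sq_norm_inner_right v, ← b.sum_sq_norm_inner_right (T v - (l : 𝕜) • v),
    Finset.mul_sum]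
  refine Finset.sum_le_sum fun i _ => ?_
  have h : inner 𝕜 (b i) (T v - (l : 𝕜) • v) = ((μ i - l : ℝ) : 𝕜) * inner 𝕜 (b i) v := by
    rw [inner_sub_right, inner_map_eq_of_eigenbasis b T μ hT, inner_smul_right]
    push_cast
    ring
  rw [h, norm_mul, mul_pow, RCLike.norm_ofReal]
  gcongr
  exact hμ i

end Spectral

/-! ### Weyl's inequality and continuity of eigenvalues -/

section Hermitian

variable {ι : Type} [Fintype ι] [DecidableEq ι] {A B : Matrix ι ι ℂ}

/-- An orthonormal eigenbasis of a Hermitian matrix, in the order of `eigenvalues₀`. -/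
noncomputable def eigenbasis₀ (hA : A.IsHermitian) :
    OrthonormalBasis (Fin (Fintype.card ι)) ℂ (EuclideanSpace ℂ ι) :=
  (Matrix.isSymmetric_toEuclideanLin_iff.mpr hA).eigenvectorBasis finrank_euclideanSpace

theorem toEuclideanLin_eigenbasis₀ (hA : A.IsHermitian) (i : Fin (Fintype.card ι)) :
    Matrix.toEuclideanLin A (eigenbasis₀ hA i) = (hA.eigenvalues₀ i : ℂ) • eigenbasis₀ hA i :=
  (Matrix.isSymmetric_toEuclideanLin_iff.mpr hA).apply_eigenvectorBasis finrank_euclideanSpace i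

/-- Weyl's inequality. -/
theorem eigenvalues₀_le_add (hA : A.IsHermitian) (hB : B.IsHermitian) {ε : ℝ}
    (hε : ∀ v : EuclideanSpace ℂ ι, RCLike.re (inner ℂ v (Matrix.toEuclideanLin A v)) ≤
      RCLike.re (inner ℂ v (Matrix.toEuclideanLin B v)) + ε * ‖v‖ ^ 2)
    (k : Fin (Fintype.card ι)) : hA.eigenvalues₀ k ≤ hB.eigenvalues₀ k + ε := by
  -- The two index sets overlap in `k`, so their sizes sum to the dimension plus one.
  refine eigenvalue_comparison (eigenbasis₀ hA) (eigenbasis₀ hB) (toEuclideanLin_eigenbasis₀ hA)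
    (toEuclideanLin_eigenbasis₀ hB) hε (S := Finset.Iic k) (S' := Finset.Ici k) ?_
    (fun i hi => hA.eigenvalues₀_antitone (Finset.mem_Iic.mp hi))
    (fun i hi => hB.eigenvalues₀_antitone (Finset.mem_Ici.mp hi))
  have := k.isLt
  simp only [Fin.card_Iic, Fin.card_Ici, Fintype.card_fin]
  omega

/-- Since `M s - M t = (s - t)(B - A)`, Weyl's inequality makes each ordered eigenvalue Lipschitz,
with constant the operator norm of `B - A`. -/
theorem continuous_eigenvalues₀_pencil {M : ℝ → Matrix ι ι ℂ} (hM : ∀ s, (M s).IsHermitian)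
    (A B : Matrix ι ι ℂ) (hMAB : ∀ s, M s = ((1 - s : ℝ) : ℂ) • A + (s : ℂ) • B)
    (k : Fin (Fintype.card ι)) : Continuous fun s => (hM s).eigenvalues₀ k := by
  set D := LinearMap.toContinuousLinearMap (Matrix.toEuclideanLin (B - A))
  have key : ∀ s t, (hM s).eigenvalues₀ k ≤ (hM t).eigenvalues₀ k + ‖D‖ * |s - t| := by
    refine fun s t => eigenvalues₀_le_add (hM s) (hM t) (fun v => ?_) k
    have h : Matrix.toEuclideanLin (M s) v =
        Matrix.toEuclideanLin (M t) v + ((s - t : ℝ) : ℂ) • D v := by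
      have : M s = M t + ((s - t : ℝ) : ℂ) • (B - A) := by
        rw [hMAB, hMAB]
        push_cast
        module
      rw [this]
      simp [D]
    rw [h, inner_add_right, map_add, inner_smul_right]
    gcongr
    calc RCLike.re (((s - t : ℝ) : ℂ) * inner ℂ v (D v))
        ≤ ‖((s - t : ℝ) : ℂ) * inner ℂ v (D v)‖ := RCLike.re_le_norm _
      _ = |s - t| * ‖inner ℂ v (D v)‖ := by rw [norm_mul, Complex.norm_real, Real.norm_eq_abs]
      _ ≤ |s - t| * (‖v‖ * (‖D‖ * ‖v‖)) := by
          gcongr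
          exact (norm_inner_le_norm _ _).trans (by gcongr; exact D.le_opNorm v)
      _ = ‖D‖ * |s - t| * ‖v‖ ^ 2 := by ring
  refine (LipschitzWith.of_dist_le_mul (K := ‖D‖₊) fun s t => ?_).continuous
  rw [Real.dist_eq, Real.dist_eq, coe_nnnorm, abs_sub_le_iff]
  have h1 := key s t
  have h2 := key t s
  rw [abs_sub_comm] at h2
  constructor <;> linarith

end Hermitian

/-! ### Action of the Hamiltonian on product vectors -/

/-- The product vector whose tensor factors are all equal to `φ`. -/
def productVector {n : ℕ} (φ : Bool → ℂ) (x : BitString n) : ℂ := ∏ i, φ (x i)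

theorem hammingWeight_eq_sum {n : ℕ} (z : BitString n) :
    (hammingWeight z : ℂ) = ∑ j, if z j = true then 1 else 0 := by
  simp [hammingWeight]

theorem sum_prod_bitString {n : ℕ} (g : Fin n → Bool → ℂ) :
    ∑ z : BitString n, ∏ i, g i (z i) = ∏ i, ∑ b, g i b := by
  rw [Finset.prod_univ_sum, Fintype.piFinset_univ]

theorem hatBit_completeness (φ : Bool → ℂ) (y : Bool) :
    ∑ b, hatBit b y * ∑ t, star (hatBit b t) * φ t = φ y := by
  have h : ((Real.sqrt 2 : ℝ) : ℂ) ^ 2 = 2 := by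
    rw [← Complex.ofReal_pow, Real.sq_sqrt (by norm_num)]
    simp
  have h0 : ((Real.sqrt 2 : ℝ) : ℂ) ≠ 0 := by
    intro h0
    simp [h0] at h
  cases y <;> simp [hatBit, ket] <;> field_simp <;> rw [h] <;> ring

theorem hatBit_projection (φ : Bool → ℂ) (y : Bool) :
    hatBit true y * ∑ t, star (hatBit true t) * φ t =
      if y = true then (φ true - φ false) / 2 else (φ false - φ true) / 2 := by
  have h : ((Real.sqrt 2 : ℝ) : ℂ) ^ 2 = 2 := by
    rw [← Complex.ofReal_pow, Real.sq_sqrt (by norm_num)]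
    simp
  have h0 : ((Real.sqrt 2 : ℝ) : ℂ) ≠ 0 := by
    intro h0
    simp [h0] at h
  cases y <;> simp [hatBit, ket, Pi.single_apply] <;> field_simp <;> rw [h] <;> ring

theorem ketbra_mulVec {ι : Type} [Fintype ι] (v u : ι → ℂ) (x : ι) :
    (ketbra v).mulVec u x = v x * ∑ y, star (v y) * u y := by
  simp [ketbra, Matrix.mulVec, dotProduct, Matrix.vecMulVec_apply, Finset.mul_sum, mul_assoc]

/-- Writing the weight as a sum of bit indicators splits the initial Hamiltonian into the
projections onto `|1̂⟩` at each qubit `j`. The other qubits contribute the identity, by completeness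
of the Hadamard basis. -/
theorem initialHamiltonian_mulVec_productVector {n : ℕ} (φ : Bool → ℂ) (x : BitString n) :
    (initialHamiltonian n).mulVec (productVector φ) x =
      ∑ j, (if x j = true then (φ true - φ false) / 2 else (φ false - φ true) / 2) *
        ∏ i ∈ Finset.univ.erase j, φ (x i) := by
  set c : Bool → ℂ := fun b => ∑ t, star (hatBit b t) * φ t with hc
  have h1 : ∀ z : BitString n, (ketbra (hatKet z)).mulVec (productVector φ) x =
      ∏ i, hatBit (z i) (x i) * c (z i) := fun z => by
    rw [ketbra_mulVec, Finset.prod_mul_distrib]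
    simp only [hc, hatKet, productVector]
    rw [← sum_prod_bitString fun i t => star (hatBit (z i) t) * φ t]
    simp [Finset.prod_mul_distrib]
  rw [initialHamiltonian, Matrix.sum_mulVec, Finset.sum_apply]
  simp only [Matrix.smul_mulVec, Pi.smul_apply, smul_eq_mul, h1, hammingWeight_eq_sum,
    Finset.sum_mul]
  rw [Finset.sum_comm]
  refine Finset.sum_congr rfl fun j _ => ?_
  -- The indicator is absorbed into the `j`-th factor, so that the sum over `z` factorises over the
  -- qubits.
  have h2 : ∀ z : BitString n, (if z j = true then 1 else 0) * ∏ i, hatBit (z i) (x i) * c (z i) =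
      ∏ i, (if i = j then (if z i = true then 1 else 0) else 1) *
        (hatBit (z i) (x i) * c (z i)) := fun z => by
    rw [Finset.prod_mul_distrib (f := fun i => if i = j then (if z i = true then (1 : ℂ) else 0)
      else 1)]
    simp
  simp only [h2]
  rw [sum_prod_bitString fun i b => (if i = j then (if b = true then 1 else 0) else 1) *
        (hatBit b (x i) * c b), ← Finset.mul_prod_erase _ _ (Finset.mem_univ j)]
  congr 1
  · rw [← hatBit_projection]
    simp [hc]
  · refine Finset.prod_congr rfl fun i hi => ?_
    simp only [if_neg (Finset.ne_of_mem_erase hi), one_mul]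
    exact hatBit_completeness φ (x i)

theorem finalHamiltonian_mulVec {n : ℕ} (f : BitString n → ℝ) (u : BitString n → ℂ)
    (x : BitString n) : (finalHamiltonian f).mulVec u x = f x * u x := by
  rw [finalHamiltonian, Matrix.sum_mulVec, Finset.sum_apply]
  simp only [Matrix.smul_mulVec, Pi.smul_apply, smul_eq_mul, ketbra_mulVec]
  rw [Finset.sum_eq_single x]
  · simp [ket, Pi.single_apply]
  · intro z _ hz
    simp [ket, Ne.symm hz]
  · simp

theorem perturbedWeight_eq {n : ℕ} (x : BitString n) :
    (perturbedWeight x : ℂ) = hammingWeight x - if x = allOnes n then (n + 1 : ℂ) else 0 := by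
  unfold perturbedWeight
  split_ifs with h
  · subst h
    simp [hammingWeight, allOnes]
  · simp

/-- If `φ` is an eigenvector of the one-qubit Hamiltonian, with eigenvalue `l`, then its `n`-fold
tensor power is an eigenvector of the Hamiltonian up to a multiple of `|1^n⟩`. -/
theorem hamiltonian_mulVec_productVector {n : ℕ} (s : ℝ) (l : ℂ) (φ : Bool → ℂ)
    (h0 : (1 - s) * ((φ false - φ true) / 2) = l * φ false)
    (h1 : (1 - s) * ((φ true - φ false) / 2) + s * φ true = l * φ true) :
    (hamiltonian (perturbedWeight (n := n)) s).mulVec (productVector φ) -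
        ((n : ℂ) * l) • productVector φ =
      Pi.single (allOnes n) (-(s * (n + 1) * φ true ^ n)) := by
  ext x
  -- This is the exact eigenvalue equation for the unperturbed weight: each qubit contributes `l`.
  have key : (1 - s : ℂ) * (initialHamiltonian n).mulVec (productVector φ) x +
      s * (hammingWeight x * productVector φ x) = n * l * productVector φ x := by
    rw [initialHamiltonian_mulVec_productVector, hammingWeight_eq_sum, Finset.sum_mul,
      Finset.mul_sum, Finset.mul_sum, ← Finset.sum_add_distrib]
    have : ∀ j ∈ (Finset.univ : Finset (Fin n)), (1 - s : ℂ) *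
        ((if x j = true then (φ true - φ false) / 2 else (φ false - φ true) / 2) *
          ∏ i ∈ Finset.univ.erase j, φ (x i)) +
        s * ((if x j = true then 1 else 0) * productVector φ x) = l * productVector φ x := by
      intro j hj
      have hp : productVector φ x = φ (x j) * ∏ i ∈ Finset.univ.erase j, φ (x i) :=
        (Finset.mul_prod_erase _ _ hj).symm
      rw [hp]
      cases hx : x j
      · simp only [Bool.false_eq_true, if_false]
        linear_combination (∏ i ∈ Finset.univ.erase j, φ (x i)) * h0
      · simp only [if_true]
        linear_combination (∏ i ∈ Finset.univ.erase j, φ (x i)) * h1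
    rw [Finset.sum_congr rfl this]
    simp [mul_assoc]
  simp only [hamiltonian, Matrix.add_mulVec, Matrix.smul_mulVec, Pi.sub_apply, Pi.add_apply,
    Pi.smul_apply, smul_eq_mul, finalHamiltonian_mulVec, perturbedWeight_eq]
  push_cast
  by_cases hx : x = allOnes n
  · have hp : productVector φ x = φ true ^ n := by simp [hx, productVector, allOnes]
    rw [if_pos hx, hx, Pi.single_eq_same, ← hx]
    linear_combination key - s * (n + 1) * hp
  · rw [if_neg hx, Pi.single_eq_of_ne hx]
    linear_combination key

theorem sum_norm_sq_productVector {n : ℕ} (φ : Bool → ℂ) :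
    ∑ x : BitString n, ‖productVector φ x‖ ^ 2 = (‖φ false‖ ^ 2 + ‖φ true‖ ^ 2) ^ n := by
  have h : ∏ _i : Fin n, ∑ b, ‖φ b‖ ^ 2 = ∑ x : BitString n, ∏ i, ‖φ (x i)‖ ^ 2 := by
    rw [Finset.prod_univ_sum, Fintype.piFinset_univ]
  simp only [productVector, norm_prod, ← Finset.prod_pow, ← h]
  simp [add_comm]

/-! ### The gap and the two lowest eigenvalues -/

section Gap

variable {ι : Type} [Fintype ι] [DecidableEq ι] [Nonempty ι] {A : Matrix ι ι ℂ}

/-- The index of the smallest entry of `eigenvalues₀`. -/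
def lastIndex (ι : Type) [Fintype ι] [Nonempty ι] : Fin (Fintype.card ι) :=
  ⟨Fintype.card ι - 1, Nat.sub_lt Fintype.card_pos (by norm_num)⟩

/-- The index of the second smallest entry of `eigenvalues₀`. -/
def penultimateIndex (ι : Type) [Fintype ι] [Nonempty ι] : Fin (Fintype.card ι) :=
  ⟨Fintype.card ι - 2, Nat.sub_lt Fintype.card_pos (by norm_num)⟩

theorem spectralGap_eq (hA : A.IsHermitian) :
    spectralGap hA = hA.eigenvalues₀ (penultimateIndex ι) - hA.eigenvalues₀ (lastIndex ι) := rfl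

theorem eigenvalues₀_last_le_penultimate (hA : A.IsHermitian) :
    hA.eigenvalues₀ (lastIndex ι) ≤ hA.eigenvalues₀ (penultimateIndex ι) :=
  hA.eigenvalues₀_antitone (Fin.mk_le_mk.mpr (by omega))

theorem spectralGap_nonneg (hA : A.IsHermitian) : 0 ≤ spectralGap hA :=
  sub_nonneg.mpr (eigenvalues₀_last_le_penultimate hA)

/-- Here `l` is the midpoint of the two lowest eigenvalues, and no eigenvalue lies strictly between
them. -/
theorem half_spectralGap_le_abs_sub (hA : A.IsHermitian) {l : ℝ}
    (hl : hA.eigenvalues₀ (penultimateIndex ι) + hA.eigenvalues₀ (lastIndex ι) = 2 * l)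
    (i : Fin (Fintype.card ι)) : spectralGap hA / 2 ≤ |hA.eigenvalues₀ i - l| := by
  rw [spectralGap_eq]
  rcases le_or_gt (i : ℕ) (Fintype.card ι - 2) with hi | hi
  · have : hA.eigenvalues₀ (penultimateIndex ι) ≤ hA.eigenvalues₀ i :=
      hA.eigenvalues₀_antitone (Fin.le_def.mpr hi)
    exact le_trans (by linarith) (le_abs_self _)
  · have : i = lastIndex ι := Fin.ext (by have := i.isLt; simp only [lastIndex]; omega)
    subst this
    exact le_trans (by linarith) (neg_le_abs _)

end Gap

/-! ### Existence of the minimum and the endpoints of the path -/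

variable {n : ℕ}

theorem continuous_eigenvalues₀_hamiltonian (f : BitString n → ℝ)
    (k : Fin (Fintype.card (BitString n))) :
    Continuous fun s => (hamiltonian_isHermitian f s).eigenvalues₀ k :=
  continuous_eigenvalues₀_pencil (hamiltonian_isHermitian f) _ _ (fun _ => rfl) k

theorem continuous_gap (f : BitString n → ℝ) : Continuous (gap f) :=
  (continuous_eigenvalues₀_hamiltonian f _).sub (continuous_eigenvalues₀_hamiltonian f _)

theorem isLeast_minGap (f : BitString n → ℝ) :
    IsLeast (gap f '' Set.Icc (0 : ℝ) 1) (minGap f) :=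
  (isCompact_Icc.image (continuous_gap f)).isLeast_sInf
    ((Set.nonempty_Icc.mpr zero_le_one).image _)

theorem minGap_nonneg (f : BitString n → ℝ) : 0 ≤ minGap f := by
  obtain ⟨s, -, hs⟩ := (isLeast_minGap f).1
  exact hs ▸ spectralGap_nonneg _

open scoped ComplexOrder in
theorem posSemidef_initialHamiltonian (n : ℕ) : (initialHamiltonian n).PosSemidef := by
  refine Matrix.posSemidef_sum _ fun z _ => ?_
  exact (Matrix.posSemidef_vecMulVec_self_star _).smul (Nat.cast_nonneg _)

open scoped ComplexOrder in
theorem eigenvalues₀_hamiltonian_zero_nonneg (f : BitString n → ℝ)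
    (k : Fin (Fintype.card (BitString n))) :
    0 ≤ (hamiltonian_isHermitian f 0).eigenvalues₀ k := by
  have h0 : (hamiltonian f 0).PosSemidef := by
    simpa [hamiltonian] using posSemidef_initialHamiltonian n
  have h := h0.eigenvalues_nonneg (Fintype.equivOfCardEq (Fintype.card_fin _) k)
  simpa only [Matrix.IsHermitian.eigenvalues, Equiv.symm_apply_apply] using h

/-- At `s = 1` the Hamiltonian is diagonal, and the distinct strings `1^n` and `0^n` supply the
eigenvalues `-1` and `0`. -/
theorem eigenvalues₀_hamiltonian_one_nonpos (hn : 1 ≤ n) :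
    (hamiltonian_isHermitian (perturbedWeight (n := n)) 1).eigenvalues₀
      (penultimateIndex (BitString n)) ≤ 0 := by
  set hA := hamiltonian_isHermitian (perturbedWeight (n := n)) 1
  have hne : allOnes n ≠ fun _ => false := fun h => by simpa [allOnes] using congrFun h ⟨0, hn⟩
  have hdiag : ∀ z : BitString n, Matrix.toEuclideanLin (hamiltonian perturbedWeight 1)
      (EuclideanSpace.basisFun (BitString n) ℂ z) =
        (perturbedWeight z : ℂ) • EuclideanSpace.basisFun (BitString n) ℂ z := fun z => by
    ext x
    simp only [hamiltonian, sub_self, Complex.ofReal_zero, zero_smul, zero_add, Complex.ofReal_one,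
      one_smul, Matrix.toLpLin_apply, finalHamiltonian_mulVec, EuclideanSpace.basisFun_apply,
      PiLp.smul_apply, smul_eq_mul, PiLp.single_apply]
    split_ifs with h
    · rw [h]
    · simp
  rw [← add_zero (0 : ℝ)]
  refine eigenvalue_comparison (eigenbasis₀ hA) (EuclideanSpace.basisFun (BitString n) ℂ)
    (toEuclideanLin_eigenbasis₀ hA) hdiag (fun v => by simp)
    (S := Finset.Iic (penultimateIndex (BitString n))) (S' := {allOnes n, fun _ => false}) ?_
    (fun i hi => hA.eigenvalues₀_antitone (Finset.mem_Iic.mp hi)) ?_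
  · rw [Finset.card_pair hne, Fin.card_Iic, Fintype.card_fin]
    simp only [penultimateIndex]
    omega
  · intro z hz
    rcases Finset.mem_insert.mp hz with rfl | hz
    · exact (if_pos rfl).trans_le (by norm_num)
    · rw [Finset.mem_singleton.mp hz]
      exact (if_neg hne.symm).trans_le (by simp [hammingWeight])

/-! ### The one-qubit ground state and the bound on the gap -/

/-- The ground state energy of the one-qubit Hamiltonian at parameter `s`. -/
noncomputable def qubitEnergy (s : ℝ) : ℝ := (1 - √(s ^ 2 + (1 - s) ^ 2)) / 2

/-- A ground state of the one-qubit Hamiltonian at parameter `s`. -/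
noncomputable def qubitGround (s : ℝ) : Bool → ℂ
  | false => (s + √(s ^ 2 + (1 - s) ^ 2) : ℝ)
  | true => (1 - s : ℝ)

theorem norm_residual_productVector_le {s : ℝ} (hs : s ∈ Set.Icc (0 : ℝ) 1) {d : ℝ} (hd : 0 ≤ d)
    (h : ∀ k, d ≤
      |(hamiltonian_isHermitian (perturbedWeight (n := n)) s).eigenvalues₀ k - n * qubitEnergy s|) :
    d ≤ (n + 1) / √(2 ^ n) := by
  set r := √(s ^ 2 + (1 - s) ^ 2) with hr
  have hr2 : r ^ 2 = s ^ 2 + (1 - s) ^ 2 := Real.sq_sqrt (by positivity)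
  have hr1 : 1 - s ≤ r := Real.le_sqrt_of_sq_le (by nlinarith [sq_nonneg s])
  have hs0 := hs.1
  have hs1 := hs.2
  have hr2' : (r : ℂ) ^ 2 = (s : ℂ) ^ 2 + (1 - s) ^ 2 := by exact_mod_cast hr2
  have hres := hamiltonian_mulVec_productVector (n := n) s (qubitEnergy s) (qubitGround s)
    (by
      simp only [qubitGround, qubitEnergy, ← hr]
      push_cast
      linear_combination (1 / 2 : ℂ) * hr2')
    (by
      simp only [qubitGround, qubitEnergy, ← hr]
      push_cast
      ring)
  set v : EuclideanSpace ℂ (BitString n) := WithLp.toLp 2 (productVector (qubitGround s)) with hv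
  set hA := hamiltonian_isHermitian (perturbedWeight (n := n)) s
  have hle := sq_mul_norm_sq_le_residual (eigenbasis₀ hA) (toEuclideanLin_eigenbasis₀ hA) hd h v
  have hTv : Matrix.toEuclideanLin (hamiltonian (perturbedWeight (n := n)) s) v -
      ((n * qubitEnergy s : ℝ) : ℂ) • v =
      EuclideanSpace.single (allOnes n) (-(s * (n + 1) * qubitGround s true ^ n)) := by
    ext x
    simpa [hv, Matrix.toLpLin_apply, Pi.single_apply] using congrFun hres x
  have hnorm : ‖v‖ ^ 2 = ((s + r) ^ 2 + (1 - s) ^ 2) ^ n := by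
    rw [EuclideanSpace.norm_sq_eq, hv]
    simp only
    rw [sum_norm_sq_productVector]
    simp only [qubitGround, Complex.norm_real, Real.norm_eq_abs, sq_abs, ← hr]
  have hnorm' : ‖Matrix.toEuclideanLin (hamiltonian (perturbedWeight (n := n)) s) v -
      ((n * qubitEnergy s : ℝ) : ℂ) • v‖ ^ 2 = (s * (n + 1)) ^ 2 * ((1 - s) ^ 2) ^ n := by
    have : (-(s * (n + 1) * qubitGround s true ^ n) : ℂ) =
        ((-(s * (n + 1) * (1 - s) ^ n) : ℝ) : ℂ) := by
      simp [qubitGround]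
    rw [hTv, PiLp.norm_single, this, Complex.norm_real, Real.norm_eq_abs, sq_abs,
      neg_sq, mul_pow, pow_right_comm]
  rw [hnorm] at hle
  replace hle := hle.trans_eq hnorm'
  -- The unnormalised ground state vanishes nowhere on `[0, 1]`.
  have hrpos : 0 < (s + r) ^ 2 := by
    have : 0 < s + r := by
      rcases hs0.eq_or_lt with h | h <;> linarith [Real.sqrt_nonneg (s ^ 2 + (1 - s) ^ 2)]
    positivity
  set q := ((s + r) ^ 2 + (1 - s) ^ 2) ^ n with hq
  have hqpos : 0 < q := by positivity
  -- Since `s + r ≥ 1 - s`, the `|1⟩` component has at most half the squared norm of each factor.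
  -- This is the source of `2^n`.
  have hq2 : 2 ^ n * ((1 - s) ^ 2) ^ n ≤ q := by
    rw [hq, ← mul_pow]
    gcongr
    nlinarith
  have hs2 : (s * (n + 1)) ^ 2 ≤ ((n : ℝ) + 1) ^ 2 := by
    gcongr
    nlinarith
  have hfin : d ^ 2 * 2 ^ n ≤ ((n : ℝ) + 1) ^ 2 := by
    refine le_of_mul_le_mul_right ?_ hqpos
    calc d ^ 2 * 2 ^ n * q = 2 ^ n * (d ^ 2 * q) := by ring
      _ ≤ 2 ^ n * ((s * (n + 1)) ^ 2 * ((1 - s) ^ 2) ^ n) := by gcongr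
      _ = (s * (n + 1)) ^ 2 * (2 ^ n * ((1 - s) ^ 2) ^ n) := by ring
      _ ≤ ((n : ℝ) + 1) ^ 2 * q := by gcongr
  rw [le_div_iff₀ (by positivity)]
  refine abs_le_of_sq_le_sq' ?_ (by positivity) |>.2
  rwa [mul_pow, Real.sq_sqrt (by positivity)]

theorem minGap_le (hn : 1 ≤ n) :
    minGap (perturbedWeight (n := n)) ≤ 4 * (n / √(2 ^ n)) := by
  set hA := hamiltonian_isHermitian (perturbedWeight (n := n))
  -- A zero of `F` is a parameter at which `n * qubitEnergy s` is the midpoint of the two lowest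
  -- eigenvalues. As `qubitEnergy` vanishes at both ends of the path, only the signs of the
  -- eigenvalues matter there.
  set F : ℝ → ℝ := fun s => (hA s).eigenvalues₀ (penultimateIndex _) +
    (hA s).eigenvalues₀ (lastIndex _) - 2 * (n * qubitEnergy s) with hF
  have hcont : Continuous F := by
    refine ((continuous_eigenvalues₀_hamiltonian _ _).add
      (continuous_eigenvalues₀_hamiltonian _ _)).sub ?_
    unfold qubitEnergy
    fun_prop
  have h0 : 0 ≤ F 0 := by
    have h1 := eigenvalues₀_hamiltonian_zero_nonneg (perturbedWeight (n := n))
    simp only [hF, qubitEnergy]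
    norm_num
    exact add_nonneg (h1 _) (h1 _)
  have h1 : F 1 ≤ 0 := by
    have h1 := eigenvalues₀_hamiltonian_one_nonpos hn
    have h2 := eigenvalues₀_last_le_penultimate (hA 1)
    simp only [hF, qubitEnergy]
    norm_num
    linarith
  obtain ⟨s, hs, hFs⟩ := intermediate_value_Icc' zero_le_one hcont.continuousOn ⟨h1, h0⟩
  have hgap := norm_residual_productVector_le (n := n) hs
    (d := gap perturbedWeight s / 2) (div_nonneg (spectralGap_nonneg _) (by norm_num))
    (half_spectralGap_le_abs_sub (hA s) (sub_eq_zero.mp hFs))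
  have hmin := (isLeast_minGap (perturbedWeight (n := n))).2 ⟨s, hs, rfl⟩
  have hn' : (1 : ℝ) ≤ n := by exact_mod_cast hn
  -- The constant 4 combines this factor 2 with the one from bounding half the gap.
  have : ((n : ℝ) + 1) / √(2 ^ n) ≤ 2 * (n / √(2 ^ n)) := by
    rw [← mul_div_assoc]
    gcongr
    linarith
  linarith

theorem le_of_meetsAdiabaticRequirement (hn : 1 ≤ n) {c T : ℝ} (hc : 0 < c)
    (h : MeetsAdiabaticRequirement (perturbedWeight (n := n)) c T) :
    (2 : ℝ) ^ n / n ^ 2 ≤ 16 / c * T := by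
  unfold MeetsAdiabaticRequirement at h
  -- The division-free requirement with `c > 0` already forces a positive delay.
  have hT : 0 < T := pos_of_mul_pos_left (hc.trans_le h) (sq_nonneg _)
  have hn' : (0 : ℝ) < n := by exact_mod_cast hn
  have hsq : minGap (perturbedWeight (n := n)) ^ 2 ≤ 16 * (n ^ 2 / 2 ^ n) := by
    calc minGap (perturbedWeight (n := n)) ^ 2 ≤ (4 * (n / √(2 ^ n))) ^ 2 :=
          pow_le_pow_left₀ (minGap_nonneg _) (minGap_le hn) 2
      _ = 16 * (n ^ 2 / 2 ^ n) := by
          rw [mul_pow, div_pow, Real.sq_sqrt (by positivity)]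
          norm_num
  have h2 : c ≤ T * (16 * (n ^ 2 / 2 ^ n)) := h.trans (by gcongr)
  rw [div_le_iff₀ (by positivity), div_mul_eq_mul_div, div_mul_eq_mul_div, le_div_iff₀ hc]
  calc (2 : ℝ) ^ n * c ≤ 2 ^ n * (T * (16 * (n ^ 2 / 2 ^ n))) := by gcongr
    _ = 16 * T * n ^ 2 := by field_simp

end Adiabatic

theorem mainTheorem1 :
    -- the minimum over `s ∈ [0, 1]` of the gap exists, and `minGap` is that minimum
    (∀ n : ℕ, 1 ≤ n →
      IsLeast (Adiabatic.gap (Adiabatic.perturbedWeight (n := n)) '' Set.Icc (0 : ℝ) 1)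
        (Adiabatic.minGap (Adiabatic.perturbedWeight (n := n)))) ∧
    -- the minimum gap is `O(n / √(2^n))`
    (fun n : ℕ => Adiabatic.minGap (Adiabatic.perturbedWeight (n := n)))
      =O[atTop] (fun n : ℕ => (n : ℝ) / Real.sqrt (2 ^ n)) ∧
    -- every delay that meets the adiabatic requirement is `Ω(2^n / n²)`
    (∀ T : ℕ → ℝ,
      (∃ c : ℝ, 0 < c ∧ ∀ᶠ n : ℕ in atTop,
        Adiabatic.MeetsAdiabaticRequirement (Adiabatic.perturbedWeight (n := n)) c (T n)) →
      (fun n : ℕ => (2 : ℝ) ^ n / (n : ℝ) ^ 2) =O[atTop] T) := by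
  refine ⟨fun n _ => Adiabatic.isLeast_minGap _, ?_, ?_⟩
  · refine IsBigO.of_bound 4 (eventually_atTop.mpr ⟨1, fun n hn => ?_⟩)
    rw [Real.norm_of_nonneg (Adiabatic.minGap_nonneg _), Real.norm_of_nonneg (by positivity)]
    exact Adiabatic.minGap_le hn
  · rintro T ⟨c, hc, hT⟩
    refine IsBigO.of_bound (16 / c) ?_
    filter_upwards [hT, eventually_ge_atTop 1] with n hn hn1
    rw [Real.norm_of_nonneg (by positivity)]
    refine (Adiabatic.le_of_meetsAdiabaticRequirement hn1 hc hn).trans ?_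
    gcongr
    exact Real.le_norm_self _
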